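/- Consider a tandem network of $M\ge 1$ queues $Q_1,\dots,Q_M$ with a single server that serves one queue at a time. Jobs arrive at $Q_1$ according to a Poisson process of rate $\lambda_1>0$; there are no other external arrivals. Service requirements at $Q_i$ are independent and exponential with mean $b_i>0$ (rate $1/b_i$). A job served at $Q_i$ joins $Q_{i+1}$ if $i<M$ and leaves the network if $i=M$. Consider a server visit to $Q_i$, with a timer that is exponential with rate $\alpha_i>0$. Under the autonomous-server discipline the visit ends when the timer expires, even if $Q_i$ has become empty meanwhile. Under the time-limited discipline it ends when the timer expires or $Q_i$ becomes empty, whichever occurs first (immediately if $Q_i$ is empty at the start). Thus during the visit the vector of queue lengths, together with the presence of the server, is the continuous-time Markov chain with the corresponding transition rates. Let ${\bf N}^b_i$ and ${\bf N}^e_i$ be the vectors of the $M$ queue lengths at the beginning and at the end of the visit; the law of ${\bf N}^b_i$ is arbitrary. Write $\mathbf z^{\mathbf n}=\prod_j z_j^{n_j}$ and put $z_{M+1}:=1$. The visit ends almost surely. Let $\mathbf z\in\mathbb C^M$ with $|z_j|\le 1$ for all $j$, and let $$P_1(r)=\lambda_1r^2-(\lambda_1+1/b_1+\alpha_1)\,r+z_2/b_1,\qquad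 P_i(r)=-(\lambda_1(1-z_1)+1/b_i+\alpha_i)\,r+z_{i+1}/b_i\quad(i>1).$$ Then $P_i$ has exactly one root $r_{1i}$ with $|r_{1i}|<1$. Put $\mathbf z^*_i=(z_1,\dots,z_{i-1},r_{1i},z_{i+1},\dots,z_M)$ and suppose that $P_i(z_i)\ne 0$. (a) Autonomous-server discipline: if $z_{i+1}\ne r_{1i}$ and $z_{i+1}\neq z_i$, then $$\mathbb E\big[\mathbf z^{{\bf N}^e_i}\big]=\frac{\alpha_i(z_{i+1}-z_i)}{P_i(z_i)}\left(\frac{r_{1i}\,\mathbb E\big[(\mathbf z^*_i)^{{\bf N}^b_i}\big]}{z_{i+1}-r_{1i}}-\frac{z_i\,\mathbb E\big[\mathbf z^{{\bf N}^b_i}\big]}{z_{i+1}-z_i}\right);$$ if $z_{i+1}\ne r_{1i}$ and $z_{i+1}=z_i$, this relation holds with the factor $z_{i+1}-z_i$ multiplied into the bracket and cancelled. (b) Time-limited discipline: $$\mathbb E\big[\mathbf z^{{\bf N}^e_i}\big]=\Big(1+\frac{\alpha_iz_i}{P_i(z_i)}\Big)\mathbb E\big[(\mathbf z^*_i)^{{\bf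 N}^b_i}\big]-\frac{\alpha_iz_i}{P_i(z_i)}\,\mathbb E\big[\mathbf z^{{\bf N}^b_i}\big].$$ -/

import Mathlib

open MeasureTheory Filter Topology
open scoped NNReal Nat

noncomputable section

/-! ### Continuous-time Markov chains with bounded transition rates -/

/-- The generator `(L f)(x) = ∑ y, q(x, y) (f y - f x)` of the transition rates `q`. -/
def rateGenerator {S : Type*} (q : S → S → ℝ) (f : S → ℂ) : S → ℂ :=
  fun x => ∑' y, (q x y : ℂ) * (f y - f x)

/-- The semigroup `exp (t L) f = ∑ k, (t ^ k / k!) L ^ k f` of the transition rates `q`, applied to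
a bounded function `f`. The series converges absolutely as soon as the total rates
`∑ y, q(x, y)` are bounded in `x`. -/
def rateSemigroup {S : Type*} (q : S → S → ℝ) (t : ℝ) (f : S → ℂ) : S → ℂ :=
  fun x => ∑' k : ℕ, ((t ^ k / (k ! : ℝ) : ℝ) : ℂ) * (rateGenerator q)^[k] f x

/-- `X` is, with respect to the filtration `ℱ`, a continuous-time Markov chain on the discrete state
space `S` with (bounded) transition rates `q`: it is adapted, almost all of its paths are right
continuous step functions, and it is Markov with transition semigroup `exp (t L)`. Its
initial distribution is arbitrary, and `ℱ 0` may contain any information on the past. -/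
structure IsMarkovJumpProcess {S Ω : Type*} [MeasurableSpace S] {mΩ : MeasurableSpace Ω}
    (q : S → S → ℝ) (ℱ : Filtration ℝ≥0 mΩ) (X : ℝ≥0 → Ω → S) (P : Measure Ω) : Prop where
  adapted : ∀ t, Measurable[ℱ t] (X t)
  right_continuous : ∀ᵐ ω ∂P, ∀ t : ℝ≥0, ∀ᶠ s in 𝓝[≥] t, X s ω = X t ω
  markov : ∀ s t : ℝ≥0, s ≤ t → ∀ f : S → ℂ, (∃ C : ℝ, ∀ x, ‖f x‖ ≤ C) →
    P[fun ω => f (X t ω) | ℱ s] =ᵐ[P] fun ω => rateSemigroup q ((t : ℝ) - s) f (X s ω)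

/-! ### A server visit in the tandem network

Queues are indexed by `Fin M`, so that `0 : Fin M` is the first queue. -/

/-- The service disciplines. -/
inductive Discipline
  | autonomous
  | timeLimited

/-- The state during a visit of the server: the queue lengths, and whether the server is still
present at the visited queue (`true`) or has ended its visit (`false`). -/
abbrev VisitState (M : ℕ) := (Fin M → ℕ) × Bool

/-- Queue lengths after a service completion at queue `i`: the job moves on to queue `i + 1`, or
leaves the network if `i` is the last queue. -/
def afterService {M : ℕ} (i : Fin M) (n : Fin M → ℕ) : Fin M → ℕ :=
  Function.update n i (n i - 1) +
    if h : (i : ℕ) + 1 < M then Pi.single (⟨(i : ℕ) + 1, h⟩ : Fin M) 1 else 0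

/-- Whether a server that finds itself at queue `i` with queue lengths `n` stays there: always
under the autonomous-server discipline, only if queue `i` is not empty under the time-limited
discipline. -/
def serverStays {M : ℕ} (d : Discipline) (i : Fin M) (n : Fin M → ℕ) : Bool :=
  match d with
  | .autonomous => true
  | .timeLimited => decide (n i ≠ 0)

/-- Transition rates during a visit to queue `i`, as long as the server is present: arrivals to the
first queue (rate `lam`), service completions at queue `i` if it is not empty (rate `1 / b i`),
expiration of the visit timer (rate `α i`). The state is frozen once the visit has ended. -/
def visitRate {M : ℕ} [NeZero M] (d : Discipline) (lam : ℝ) (b α : Fin M → ℝ) (i : Fin M)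
    (x y : VisitState M) : ℝ :=
  if x.2 = true then
    (if y = (x.1 + Pi.single 0 1, true) then lam else 0) +
    (if x.1 i ≠ 0 ∧ y = (afterService i x.1, serverStays d i (afterService i x.1))
      then 1 / b i else 0) +
    (if y = (x.1, false) then α i else 0)
  else 0

/-- `X` describes a server visit to queue `i`, started at time `0`: it is a Markov chain with
the rates `visitRate`, and the server is present at time `0`, unless the discipline makes it
leave at once. -/
structure IsServerVisit {M : ℕ} [NeZero M] {Ω : Type*} {mΩ : MeasurableSpace Ω} (d : Discipline)
    (lam : ℝ) (b α : Fin M → ℝ) (i : Fin M) (ℱ : Filtration ℝ≥0 mΩ)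
    (X : ℝ≥0 → Ω → VisitState M) (P : Measure Ω) : Prop where
  chain : IsMarkovJumpProcess (visitRate d lam b α i) ℱ X P
  start : ∀ᵐ ω ∂P, (X 0 ω).2 = serverStays d i (X 0 ω).1

/-- The joint queue length `N^b` at the beginning of the visit. -/
def queuesAtBegin {M : ℕ} {Ω : Type*} (X : ℝ≥0 → Ω → VisitState M) (ω : Ω) : Fin M → ℕ :=
  (X 0 ω).1

/-- The time at which the visit ends. -/
def visitEnd {M : ℕ} {Ω : Type*} (X : ℝ≥0 → Ω → VisitState M) (ω : Ω) : ℝ≥0 :=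
  sInf {t | (X t ω).2 = false}

/-- The joint queue length `N^e` at the end of the visit. -/
def queuesAtEnd {M : ℕ} {Ω : Type*} (X : ℝ≥0 → Ω → VisitState M) (ω : Ω) : Fin M → ℕ :=
  (X (visitEnd X ω) ω).1

/-- The joint probability generating function `E[z ^ N] = E[∏ j, z j ^ N j]`. -/
def jointPGF {M : ℕ} {Ω : Type*} {mΩ : MeasurableSpace Ω} (P : Measure Ω) (N : Ω → Fin M → ℕ)
    (z : Fin M → ℂ) : ℂ :=
  ∫ ω, ∏ j, z j ^ N ω j ∂P

/-! ### The kernel polynomial -/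

/-- The variable `z_{i+1}` of the queue that a job joins after service at queue `i`, with value `1`
if the job leaves the network. -/
def nextVar {M : ℕ} (i : Fin M) (z : Fin M → ℂ) : ℂ :=
  if h : (i : ℕ) + 1 < M then z ⟨(i : ℕ) + 1, h⟩ else 1

/-- The polynomial `P_i(r)`. -/
def kernelPoly {M : ℕ} [NeZero M] (lam : ℝ) (b α : Fin M → ℝ) (i : Fin M) (z : Fin M → ℂ)
    (r : ℂ) : ℂ :=
  if i = 0 then
    lam * r ^ 2 - (lam + 1 / b i + α i) * r + nextVar i z / b i
  else
    -(lam * (1 - z 0) + 1 / b i + α i) * r + nextVar i z / b i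

end

/-!
The relations are instances of optional stopping for a harmonic function of the Markov chain. Let
`z*` be `z` with the entry of the visited queue `i` replaced by the root `r`. For suitable constants
`A` and `B` the bounded function `visitHarmonic`,
`h (n, true) = A z* ^ n - B z ^ n` and `h (n, false) = z ^ n`,
is annihilated by the generator on `admissibleStates`, a closed class in which the visit starts:

* at `n i ≠ 0` (`rateGenerator_visitHarmonic_of_ne_zero`) this says that `r` is a root of the kernel
  polynomial and `B = α i z i / P (z i)`;
* at `n i = 0` under the autonomous-server discipline
  (`rateGenerator_visitHarmonic_of_eq_zero`) it forces
  `A = α i (z_{i+1} - z i) r / (P (z i) (z_{i+1} - r))`;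
* under the time-limited discipline the server leaves on emptying the queue, so `A z* ^ n - B z ^ n`
  has to match `z ^ n` when `n i = 0`, and `A = 1 + B`.

Hence `E h (X t)` is constant in `t` (`IsMarkovJumpProcess.integral_comp_eq_of_harmonic`). The states
without server are absorbing and are reached almost surely, because the probability of presence
decays geometrically (`IsServerVisit.exists_presence_decay`). So `X t` is eventually equal to
`(N^e, false)`, and dominated convergence gives `E z ^ N^e = E h (X 0)`
(`IsServerVisit.integral_end_eq_of_harmonic`), which is the asserted relation.

The kernel polynomial is quadratic for the first queue and linear for the others; that exactly one
root lies in the open unit disc follows from comparing its coefficients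
(`existsUnique_kernelPoly_root`).
-/

/-! ### Bounded generators and their semigroups -/

section Generator

variable {S : Type*} {q : S → S → ℝ}

theorem rateGenerator_congr_of_closed {C : Set S} (hC : ∀ x ∈ C, ∀ y ∉ C, q x y = 0)
    {f g : S → ℂ} (hfg : ∀ x ∈ C, f x = g x) :
    ∀ x ∈ C, rateGenerator q f x = rateGenerator q g x := by
  intro x hx
  refine tsum_congr fun y => ?_
  by_cases hy : y ∈ C
  · rw [hfg x hx, hfg y hy]
  · simp [hC x hx y hy]

theorem rateGenerator_zero : rateGenerator q (fun _ => 0) = fun _ => 0 := by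
  funext x
  simp [rateGenerator]

/-- Iterates of the generator vanish on a closed class as soon as the first one does. -/
theorem rateGenerator_iterate_succ_eq_zero {C : Set S} (hC : ∀ x ∈ C, ∀ y ∉ C, q x y = 0)
    {f : S → ℂ} (hf : ∀ x ∈ C, rateGenerator q f x = 0) (k : ℕ) :
    ∀ x ∈ C, (rateGenerator q)^[k + 1] f x = 0 := by
  induction k with
  | zero => simpa using hf
  | succ k ih =>
    intro x hx
    rw [Function.iterate_succ_apply',
      rateGenerator_congr_of_closed hC (g := fun _ => 0) ih x hx, rateGenerator_zero]

/-- The semigroup leaves a function unchanged on a closed class on which it is harmonic. -/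
theorem rateSemigroup_eq_self {C : Set S} (hC : ∀ x ∈ C, ∀ y ∉ C, q x y = 0)
    {f : S → ℂ} (hf : ∀ x ∈ C, rateGenerator q f x = 0) (t : ℝ) :
    ∀ x ∈ C, rateSemigroup q t f x = f x := by
  intro x hx
  unfold rateSemigroup
  rw [tsum_eq_single 0]
  · simp
  · intro k hk
    obtain ⟨k, rfl⟩ := Nat.exists_eq_succ_of_ne_zero hk
    rw [Nat.succ_eq_add_one, rateGenerator_iterate_succ_eq_zero hC hf k x hx, mul_zero]

theorem rateSemigroup_eq_self_of_absorbing {x : S} (hx : ∀ y, q x y = 0) (f : S → ℂ) (t : ℝ) :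
    rateSemigroup q t f x = f x := by
  refine rateSemigroup_eq_self (C := {x}) ?_ ?_ t x rfl
  · rintro _ rfl y _
    exact hx y
  · rintro _ rfl
    simp [rateGenerator, hx]

theorem norm_rateGenerator_iterate_le {K : ℝ}
    (hK : ∀ (f : S → ℂ) (C : ℝ), (∀ x, ‖f x‖ ≤ C) → ∀ x, ‖rateGenerator q f x‖ ≤ K * C)
    {f : S → ℂ} {C : ℝ} (hf : ∀ x, ‖f x‖ ≤ C) (k : ℕ) :
    ∀ x, ‖(rateGenerator q)^[k] f x‖ ≤ K ^ k * C := by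
  induction k with
  | zero => simpa using hf
  | succ k ih =>
    intro x
    rw [Function.iterate_succ_apply', pow_succ', mul_assoc]
    exact hK _ _ ih x

/-- First-order Taylor estimate `exp (t L) f = f + t L f + O(t ^ 2)` for a generator of norm at
most `K`. -/
theorem norm_rateSemigroup_sub_le {K : ℝ} (hK0 : 0 ≤ K)
    (hK : ∀ (f : S → ℂ) (C : ℝ), (∀ x, ‖f x‖ ≤ C) → ∀ x, ‖rateGenerator q f x‖ ≤ K * C)
    {f : S → ℂ} {C : ℝ} (hf : ∀ x, ‖f x‖ ≤ C) {t : ℝ} (ht : 0 ≤ t) (htK : t * K ≤ 1) (x : S) :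
    ‖rateSemigroup q t f x - (f x + t * rateGenerator q f x)‖ ≤ (t * K) ^ 2 * C := by
  have hC : 0 ≤ C := (norm_nonneg _).trans (hf x)
  set u : ℕ → ℂ := fun k =>
    ((t ^ k / (k ! : ℝ) : ℝ) : ℂ) * (rateGenerator q)^[k] f x with hu
  set v : ℕ → ℝ := fun k => (t * K) ^ k / (k ! : ℝ) * C with hv
  have huv : ∀ k, ‖u k‖ ≤ v k := by
    intro k
    have h0 : (0 : ℝ) ≤ t ^ k / (k ! : ℝ) := by positivity
    rw [hu, hv]
    simp only [norm_mul, Complex.norm_real, Real.norm_of_nonneg h0]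
    calc t ^ k / (k ! : ℝ) * ‖(rateGenerator q)^[k] f x‖
        ≤ t ^ k / (k ! : ℝ) * (K ^ k * C) :=
          mul_le_mul_of_nonneg_left (norm_rateGenerator_iterate_le hK hf k x) h0
      _ = _ := by rw [mul_pow]; ring
  have hvs : HasSum v (Real.exp (t * K) * C) := by
    rw [Real.exp_eq_exp_ℝ]
    exact (NormedSpace.expSeries_div_hasSum_exp (t * K)).mul_right C
  have hus : Summable u := Summable.of_norm_bounded hvs.summable huv
  have e1 : rateSemigroup q t f x = u 0 + u 1 + ∑' k, u (k + 2) := by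
    rw [show rateSemigroup q t f x = ∑' k, u k from rfl, ← hus.sum_add_tsum_nat_add 2]
    simp [Finset.sum_range_succ]
  have e2 : u 0 + u 1 = f x + t * rateGenerator q f x := by simp [hu]
  have e3 : ∑' k, v (k + 2) = (Real.exp (t * K) - 1 - t * K) * C := by
    have := hvs.summable.sum_add_tsum_nat_add 2
    rw [hvs.tsum_eq] at this
    simp [Finset.sum_range_succ, hv] at this
    simp only [hv]
    linarith
  have hv2 : Summable fun k => v (k + 2) := (summable_nat_add_iff 2).2 hvs.summable
  rw [e1, e2, add_sub_cancel_left]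
  refine (tsum_of_norm_bounded hv2.hasSum fun k => huv (k + 2)).trans ?_
  rw [e3]
  refine mul_le_mul_of_nonneg_right ((le_abs_self _).trans ?_) hC
  refine Real.abs_exp_sub_one_sub_id_le ?_
  rwa [abs_of_nonneg (by positivity)]

end Generator

/-! ### Expectations along a Markov jump process -/

namespace IsMarkovJumpProcess

variable {S Ω : Type*} [MeasurableSpace S] {mΩ : MeasurableSpace Ω}
  {q : S → S → ℝ} {ℱ : Filtration ℝ≥0 mΩ} {X : ℝ≥0 → Ω → S} {P : Measure Ω}

theorem measurable (hX : IsMarkovJumpProcess q ℱ X P) (t : ℝ≥0) : Measurable (X t) :=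
  (hX.adapted t).mono (ℱ.le t) le_rfl

variable [IsProbabilityMeasure P]

theorem integrable_comp [DiscreteMeasurableSpace S] (hX : IsMarkovJumpProcess q ℱ X P)
    (t : ℝ≥0) {f : S → ℂ} (hf : ∃ C : ℝ, ∀ x, ‖f x‖ ≤ C) : Integrable (fun ω => f (X t ω)) P := by
  obtain ⟨C, hC⟩ := hf
  exact Integrable.of_bound
    ((Measurable.of_discrete (f := f)).comp (hX.measurable t)).aestronglyMeasurable C
    (Eventually.of_forall fun ω => hC _)

theorem integral_comp (hX : IsMarkovJumpProcess q ℱ X P) {s t : ℝ≥0} (hst : s ≤ t) {f : S → ℂ}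
    (hf : ∃ C : ℝ, ∀ x, ‖f x‖ ≤ C) :
    ∫ ω, f (X t ω) ∂P = ∫ ω, rateSemigroup q ((t : ℝ) - s) f (X s ω) ∂P := by
  rw [← integral_condExp (ℱ.le s)]
  exact integral_congr_ae (hX.markov s t hst f hf)

/-- The expectation of a function that is harmonic on a closed class does not change in time. -/
theorem integral_comp_eq_of_harmonic (hX : IsMarkovJumpProcess q ℱ X P) {C : Set S}
    (hC : ∀ x ∈ C, ∀ y ∉ C, q x y = 0) (h0 : ∀ᵐ ω ∂P, X 0 ω ∈ C) {f : S → ℂ}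
    (hb : ∃ C : ℝ, ∀ x, ‖f x‖ ≤ C) (hf : ∀ x ∈ C, rateGenerator q f x = 0) (t : ℝ≥0) :
    ∫ ω, f (X t ω) ∂P = ∫ ω, f (X 0 ω) ∂P := by
  rw [hX.integral_comp zero_le hb]
  refine integral_congr_ae ?_
  filter_upwards [h0] with ω hω
  exact rateSemigroup_eq_self hC hf _ _ hω

theorem ae_eq_of_absorbing [DiscreteMeasurableSpace S] (hX : IsMarkovJumpProcess q ℱ X P)
    {s t : ℝ≥0} (hst : s ≤ t) {x : S} (hx : ∀ y, q x y = 0) : ∀ᵐ ω ∂P, X s ω = x → X t ω = x := by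
  classical
  set f : S → ℂ := fun y => if y = x then 0 else 1 with hf
  have hfb : ∃ C : ℝ, ∀ y, ‖f y‖ ≤ C := ⟨1, fun y => by by_cases h : y = x <;> simp [hf, h]⟩
  have hA : MeasurableSet[ℱ s] (X s ⁻¹' {x}) := hX.adapted s (MeasurableSet.of_discrete)
  have hA' : MeasurableSet (X s ⁻¹' {x}) := ℱ.le s _ hA
  have hB : MeasurableSet (X t ⁻¹' {x}ᶜ) := hX.measurable t (MeasurableSet.of_discrete)
  have h1 : ∫ ω in X s ⁻¹' {x}, f (X t ω) ∂P = 0 := by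
    rw [← setIntegral_condExp (ℱ.le s) (hX.integrable_comp t hfb) hA,
      setIntegral_congr_ae (g := fun _ => (0 : ℂ)) hA']
    · simp
    · filter_upwards [hX.markov s t hst f hfb] with ω hω hm
      have hm' : X s ω = x := hm
      rw [hω, hm', rateSemigroup_eq_self_of_absorbing hx]
      simp [hf]
  have h2 : (fun ω => f (X t ω)) = (X t ⁻¹' {x}ᶜ).indicator fun _ => (1 : ℂ) := by
    funext ω
    by_cases h : X t ω = x <;> simp [hf, h]
  rw [h2, setIntegral_indicator hB, setIntegral_const] at h1
  have h3 : P (X s ⁻¹' {x} ∩ X t ⁻¹' {x}ᶜ) = 0 := by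
    simpa [measureReal_eq_zero_iff] using h1
  filter_upwards [measure_eq_zero_iff_ae_notMem.1 h3] with ω hω hs
  by_contra hne
  exact hω ⟨hs, hne⟩

end IsMarkovJumpProcess

/-! ### The generator of a server visit -/

section Visit

variable {M : ℕ} [NeZero M] (d : Discipline) (lam : ℝ) (b α : Fin M → ℝ) (i : Fin M)

theorem visitRate_false (n : Fin M → ℕ) (y : VisitState M) :
    visitRate d lam b α i (n, false) y = 0 := by
  simp [visitRate]

theorem rateGenerator_visitRate_false (f : VisitState M → ℂ) (n : Fin M → ℕ) :
    rateGenerator (visitRate d lam b α i) f (n, false) = 0 := by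
  simp [rateGenerator, visitRate_false]

theorem rateGenerator_visitRate_true (f : VisitState M → ℂ) (n : Fin M → ℕ) :
    rateGenerator (visitRate d lam b α i) f (n, true) =
      lam * (f (n + Pi.single 0 1, true) - f (n, true)) +
      (if n i ≠ 0 then (1 / b i : ℂ) *
        (f (afterService i n, serverStays d i (afterService i n)) - f (n, true)) else 0) +
      α i * (f (n, false) - f (n, true)) := by
  have key (c : ℝ) (p : Prop) [Decidable p] (a : VisitState M) :
      HasSum (fun y => ((if p ∧ y = a then c else 0 : ℝ) : ℂ) * (f y - f (n, true)))
        (if p then (c : ℂ) * (f a - f (n, true)) else 0) := by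
    have := hasSum_single (f := fun y =>
      ((if p ∧ y = a then c else 0 : ℝ) : ℂ) * (f y - f (n, true))) a
      (fun y hy => by simp [hy])
    convert this using 1
    by_cases hp : p <;> simp [hp]
  have h := ((key lam True (n + Pi.single 0 1, true)).add
    (key (1 / b i) (n i ≠ 0) (afterService i n, serverStays d i (afterService i n)))).add
    (key (α i) True (n, false))
  refine Eq.trans ?_ (h.tsum_eq.trans ?_)
  · refine tsum_congr fun y => ?_
    simp only [visitRate, true_and, if_true]
    push_cast
    ring
  · simp

theorem norm_rateGenerator_visitRate_le (hlam : 0 < lam) (hb : 0 < b i) (hα : 0 < α i)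
    (f : VisitState M → ℂ) (C : ℝ) (hf : ∀ x, ‖f x‖ ≤ C) (x : VisitState M) :
    ‖rateGenerator (visitRate d lam b α i) f x‖ ≤ 2 * (lam + 1 / b i + α i) * C := by
  have hC : 0 ≤ C := (norm_nonneg _).trans (hf x)
  have key (c : ℝ) (hc : 0 < c) (y z : VisitState M) :
      ‖(c : ℂ) * (f y - f z)‖ ≤ 2 * c * C := by
    rw [norm_mul, Complex.norm_real, Real.norm_of_nonneg hc.le]
    have := (norm_sub_le (f y) (f z)).trans (add_le_add (hf y) (hf z))
    nlinarith
  obtain ⟨n, _ | _⟩ := x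
  · rw [rateGenerator_visitRate_false, norm_zero]
    positivity
  · rw [rateGenerator_visitRate_true]
    have h2 : ‖(if n i ≠ 0 then (1 / b i : ℂ) *
        (f (afterService i n, serverStays d i (afterService i n)) - f (n, true)) else 0)‖
        ≤ 2 * (1 / b i) * C := by
      split_ifs
      · exact_mod_cast key (1 / b i) (by positivity) _ _
      · rw [norm_zero]
        positivity
    refine (norm_add₃_le.trans (add_le_add (add_le_add (key lam hlam _ _) h2)
      (key (α i) hα _ _))).trans (le_of_eq ?_)
    ring

/-- The states in which the server is only present where the discipline lets it stay: a closed
class that contains all states in which a visit can start. -/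
def admissibleStates : Set (VisitState M) := {x | x.2 = true → serverStays d i x.1 = true}

theorem visitRate_eq_zero_of_notMem :
    ∀ x ∈ admissibleStates d i, ∀ y ∉ admissibleStates d i, visitRate d lam b α i x y = 0 := by
  rintro ⟨n, s⟩ hx y hy
  cases s
  · exact visitRate_false d lam b α i n y
  have hs : serverStays d i n = true := hx rfl
  have h1 : y ≠ (n + Pi.single 0 1, true) := by
    rintro rfl
    refine hy fun _ => ?_
    cases d
    · rfl
    · simp only [serverStays, decide_eq_true_eq] at hs ⊢
      simp [hs]
  have h2 : y ≠ (afterService i n, serverStays d i (afterService i n)) := by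
    rintro rfl
    exact hy fun h => h
  have h3 : y ≠ (n, false) := by
    rintro rfl
    exact hy fun h => absurd h (by simp)
  simp [visitRate, h1, h2, h3]

end Visit

/-! ### The end of a visit -/

namespace IsServerVisit

variable {M : ℕ} [NeZero M] {d : Discipline} {lam : ℝ} {b α : Fin M → ℝ} {i : Fin M}
  {Ω : Type*} {mΩ : MeasurableSpace Ω} {ℱ : Filtration ℝ≥0 mΩ} {X : ℝ≥0 → Ω → VisitState M}
  {P : Measure Ω}

theorem ae_mem_admissibleStates (hX : IsServerVisit d lam b α i ℱ X P) :
    ∀ᵐ ω ∂P, X 0 ω ∈ admissibleStates d i := by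
  filter_upwards [hX.start] with ω h h'
  rwa [← h]

variable [IsProbabilityMeasure P]

/-- Over any period of a suitable fixed length, the probability that the server is still present
decreases by a constant factor: to first order in the length `δ`, the probability of leaving is at
least `α i * δ`, whatever the queue lengths are. -/
theorem exists_presence_decay (hX : IsServerVisit d lam b α i ℱ X P) (hlam : 0 < lam)
    (hb : 0 < b i) (hα : 0 < α i) :
    ∃ δ : ℝ≥0, ∃ c : ℝ, 0 ≤ c ∧ c < 1 ∧ ∀ t : ℝ≥0,
      P.real {ω | (X (t + δ) ω).2 = true} ≤ c * P.real {ω | (X t ω).2 = true} := by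
  set f : VisitState M → ℂ := fun x => if x.2 = true then 1 else 0 with hf
  have hf1 : ∀ x, ‖f x‖ ≤ 1 := fun x => by by_cases h : x.2 = true <;> simp [hf, h]
  set K : ℝ := 2 * (lam + 1 / b i + α i) with hK
  have hμ : 0 < 1 / b i := by positivity
  have hK0 : 0 < K := by positivity
  set δ : ℝ := α i / (2 * K ^ 2) with hδ
  have hδ0 : 0 < δ := by positivity
  have hδK : δ * K ^ 2 = α i / 2 := by
    rw [hδ]
    field_simp
  have hδK1 : δ * K ≤ 1 := by
    have : δ * K * K ≤ 1 * K := by nlinarith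
    exact le_of_mul_le_mul_right this hK0
  have hc0 : 0 ≤ 1 - δ * α i / 2 := by nlinarith
  refine ⟨δ.toNNReal, 1 - δ * α i / 2, hc0, by nlinarith, fun t => ?_⟩
  have hp (t : ℝ≥0) : Integrable (fun ω => if (X t ω).2 = true then (1 : ℝ) else 0) P ∧
      ∫ ω, (if (X t ω).2 = true then (1 : ℝ) else 0) ∂P = P.real {ω | (X t ω).2 = true} := by
    have hm : MeasurableSet {ω | (X t ω).2 = true} :=
      (measurable_snd.comp (hX.chain.measurable t)) (measurableSet_singleton true)
    have e : (fun ω => if (X t ω).2 = true then (1 : ℝ) else 0) =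
        {ω | (X t ω).2 = true}.indicator fun _ => 1 := by
      funext ω
      simp [Set.indicator_apply]
    rw [e]
    exact ⟨(integrable_const 1).indicator hm, integral_indicator_one hm⟩
  have hfX (t : ℝ≥0) : ∫ ω, f (X t ω) ∂P = (P.real {ω | (X t ω).2 = true} : ℂ) := by
    rw [← (hp t).2, ← integral_complex_ofReal]
    refine integral_congr_ae (Eventually.of_forall fun ω => ?_)
    by_cases h : (X t ω).2 = true <;> simp [hf, h]
  have hsemi : ∀ x : VisitState M, ‖rateSemigroup (visitRate d lam b α i) δ f x‖ ≤
      (1 - δ * α i / 2) * (if x.2 = true then (1 : ℝ) else 0) := by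
    rintro ⟨n, _ | _⟩
    · rw [rateSemigroup_eq_self_of_absorbing (visitRate_false d lam b α i n)]
      simp [hf]
    · have h1 := norm_rateSemigroup_sub_le hK0.le
        (norm_rateGenerator_visitRate_le d lam b α i hlam hb hα) hf1 hδ0.le hδK1 (n, true)
      have h2 : ∃ m : ℝ, 0 ≤ m ∧ m ≤ 1 / b i ∧
          f (n, true) + δ * rateGenerator (visitRate d lam b α i) f (n, true) =
            ((1 - δ * (m + α i) : ℝ) : ℂ) := by
        rw [rateGenerator_visitRate_true]
        by_cases hn : n i ≠ 0 ∧ serverStays d i (afterService i n) = false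
        · exact ⟨1 / b i, hμ.le, le_rfl, by simp [hf, hn]; ring⟩
        · refine ⟨0, le_rfl, hμ.le, ?_⟩
          by_cases hn0 : n i = 0
          · simp [hf, hn0]
            ring
          · have : serverStays d i (afterService i n) = true := by simpa [hn0] using hn
            simp [hf, this]
            ring
      obtain ⟨m, hm0, hm1, h2⟩ := h2
      rw [h2] at h1
      have h3 : 0 ≤ 1 - δ * (m + α i) := by nlinarith
      have h4 := norm_le_norm_add_norm_sub' (rateSemigroup (visitRate d lam b α i) δ f (n, true))
        ((1 - δ * (m + α i) : ℝ) : ℂ)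
      rw [Complex.norm_real, Real.norm_of_nonneg h3] at h4
      simp only [if_true, mul_one]
      nlinarith
  have h1 := hX.chain.integral_comp (s := t) (t := t + δ.toNNReal) le_self_add (f := f) ⟨1, hf1⟩
  rw [hfX] at h1
  have e : ((t + δ.toNNReal : ℝ≥0) : ℝ) - t = δ := by
    rw [NNReal.coe_add, add_sub_cancel_left, Real.coe_toNNReal δ hδ0.le]
  rw [e] at h1
  calc P.real {ω | (X (t + δ.toNNReal) ω).2 = true}
      = ‖(P.real {ω | (X (t + δ.toNNReal) ω).2 = true} : ℂ)‖ := by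
        rw [Complex.norm_real, Real.norm_of_nonneg measureReal_nonneg]
    _ ≤ ∫ ω, (1 - δ * α i / 2) * (if (X t ω).2 = true then (1 : ℝ) else 0) ∂P := by
        rw [h1]
        exact norm_integral_le_of_norm_le ((hp t).1.const_mul _)
          (Eventually.of_forall fun ω => hsemi _)
    _ = _ := by rw [integral_const_mul, (hp t).2]

theorem ae_exists_absent (hX : IsServerVisit d lam b α i ℱ X P) (hlam : 0 < lam)
    (hb : 0 < b i) (hα : 0 < α i) : ∀ᵐ ω ∂P, ∃ t, (X t ω).2 = false := by
  obtain ⟨δ, c, hc0, hc1, h⟩ := hX.exists_presence_decay hlam hb hα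
  have hk : ∀ k : ℕ, P.real {ω | (X (k * δ) ω).2 = true} ≤ c ^ k := by
    intro k
    induction k with
    | zero => simp
    | succ k ih =>
      rw [Nat.cast_succ, add_one_mul, pow_succ']
      exact (h _).trans (mul_le_mul_of_nonneg_left ih hc0)
  have h0 : P.real {ω | ∀ t, (X t ω).2 = true} ≤ 0 := by
    refine ge_of_tendsto (tendsto_pow_atTop_nhds_zero_of_lt_one hc0 hc1)
      (Eventually.of_forall fun k => le_trans ?_ (hk k))
    exact measureReal_mono fun ω hω => hω _
  have h1 : P {ω | ∀ t, (X t ω).2 = true} = 0 :=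
    (measureReal_eq_zero_iff).1 (le_antisymm h0 measureReal_nonneg)
  filter_upwards [measure_eq_zero_iff_ae_notMem.1 h1] with ω hω
  simpa using hω

/-- Almost every path reaches a state without server at the time `visitEnd`, and stays there: this
holds between times of a countable dense set because such states are absorbing, and extends to the
time `visitEnd` by right continuity. -/
theorem ae_eventually_eq_visitEnd (hX : IsServerVisit d lam b α i ℱ X P) (hlam : 0 < lam)
    (hb : 0 < b i) (hα : 0 < α i) :
    ∀ᵐ ω ∂P, ∀ᶠ k : ℕ in atTop, X k ω = (queuesAtEnd X ω, false) := by
  obtain ⟨D, hDc, hDd⟩ := TopologicalSpace.exists_countable_dense ℝ≥0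
  have hfreeze : ∀ᵐ ω ∂P, ∀ s ∈ D, ∀ k : ℕ, ∀ n : Fin M → ℕ, s ≤ k → X s ω = (n, false) →
      X k ω = (n, false) := by
    rw [ae_ball_iff hDc]
    intro s _
    rw [ae_all_iff]
    intro k
    rw [ae_all_iff]
    intro n
    by_cases hsk : s ≤ k
    · filter_upwards [hX.chain.ae_eq_of_absorbing hsk (visitRate_false d lam b α i n)]
        with ω h _ using h
    · exact Eventually.of_forall fun ω h => absurd h hsk
  filter_upwards [hfreeze, hX.chain.right_continuous, hX.ae_exists_absent hlam hb hα]
    with ω hfr hrc hex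
  set T := visitEnd X ω with hT
  -- The path is constant on some `[T, u)`.
  obtain ⟨u, hu, huT⟩ := (mem_nhdsGE_iff_exists_Ico_subset).1 (hrc T)
  have hTu : T < u := hu
  -- The infimum is attained, as absence times exist in `[T, u)`.
  have hTf : (X T ω).2 = false := by
    obtain ⟨s, hs, hsu⟩ := exists_lt_of_csInf_lt (s := {t | (X t ω).2 = false}) hex hTu
    have hTs : T ≤ s := csInf_le (OrderBot.bddBelow _) hs
    have e : X s ω = X T ω := huT ⟨hTs, hsu⟩
    rw [← e]
    exact hs
  have hXT : X T ω = (queuesAtEnd X ω, false) := Prod.ext rfl hTf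
  obtain ⟨s, hsD, hTs, hsu⟩ := hDd.exists_between hTu
  have hs : X s ω = (queuesAtEnd X ω, false) := (huT ⟨hTs.le, hsu⟩ : X s ω = X T ω).trans hXT
  obtain ⟨k₀, hk₀⟩ := exists_nat_ge s
  filter_upwards [eventually_ge_atTop k₀] with k hk
  exact hfr s hsD k _ (hk₀.trans (by exact_mod_cast hk)) hs

theorem aemeasurable_queuesAtEnd (hX : IsServerVisit d lam b α i ℱ X P) (hlam : 0 < lam)
    (hb : 0 < b i) (hα : 0 < α i) : AEMeasurable (queuesAtEnd X) P := by
  refine aemeasurable_of_tendsto_metrizable_ae atTop (f := fun (k : ℕ) ω => (X k ω).1)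
    (fun k => (measurable_fst.comp (hX.chain.measurable k)).aemeasurable) ?_
  filter_upwards [hX.ae_eventually_eq_visitEnd hlam hb hα] with ω h
  refine tendsto_nhds_of_eventually_eq ?_
  filter_upwards [h] with k hk
  rw [hk]

/-- If `h` is harmonic on the admissible states, its expectation at the end of the visit equals
its expectation at the beginning. -/
theorem integral_end_eq_of_harmonic (hX : IsServerVisit d lam b α i ℱ X P) (hlam : 0 < lam)
    (hb : 0 < b i) (hα : 0 < α i) {h : VisitState M → ℂ} (hbd : ∃ C : ℝ, ∀ x, ‖h x‖ ≤ C)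
    (hharm : ∀ n, serverStays d i n = true →
      rateGenerator (visitRate d lam b α i) h (n, true) = 0) :
    ∫ ω, h (queuesAtEnd X ω, false) ∂P = ∫ ω, h (X 0 ω) ∂P := by
  have hharm' : ∀ x ∈ admissibleStates d i,
      rateGenerator (visitRate d lam b α i) h x = 0 := by
    rintro ⟨n, _ | _⟩ hx
    · exact rateGenerator_visitRate_false d lam b α i h n
    · exact hharm n (hx rfl)
  have hconst (k : ℕ) : ∫ ω, h (X k ω) ∂P = ∫ ω, h (X 0 ω) ∂P :=
    hX.chain.integral_comp_eq_of_harmonic (visitRate_eq_zero_of_notMem d lam b α i)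
      hX.ae_mem_admissibleStates hbd hharm' k
  have hlim : Tendsto (fun k : ℕ => ∫ ω, h (X k ω) ∂P) atTop
      (𝓝 (∫ ω, h (queuesAtEnd X ω, false) ∂P)) := by
    obtain ⟨C, hC⟩ := hbd
    refine tendsto_integral_of_dominated_convergence (fun _ => C)
      (fun k => (hX.chain.integrable_comp k ⟨C, hC⟩).aestronglyMeasurable)
      (integrable_const C) (fun k => Eventually.of_forall fun ω => hC _) ?_
    filter_upwards [hX.ae_eventually_eq_visitEnd hlam hb hα] with ω hω
    refine tendsto_nhds_of_eventually_eq ?_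
    filter_upwards [hω] with k hk
    rw [hk]
  exact tendsto_nhds_unique hlim (by simp only [hconst]; exact tendsto_const_nhds)

end IsServerVisit

/-! ### The root of the kernel polynomial -/

section Kernel

variable {M : ℕ} {i : Fin M} {z : Fin M → ℂ}

theorem nextVar_update (r : ℂ) : nextVar i (Function.update z i r) = nextVar i z := by
  unfold nextVar
  split_ifs with h
  · rw [Function.update_of_ne]
    intro h'
    have := congrArg Fin.val h'
    simp at this
  · rfl

theorem norm_nextVar_le (hz : ∀ j, ‖z j‖ ≤ 1) : ‖nextVar i z‖ ≤ 1 := by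
  unfold nextVar
  split_ifs
  · exact hz _
  · simp

variable [NeZero M] {lam : ℝ} {b α : Fin M → ℝ}

theorem kernelPoly_apply_self : kernelPoly lam b α i z (z i) =
    lam * (z 0 - 1) * z i + (nextVar i z - z i) / b i - α i * z i := by
  unfold kernelPoly
  split_ifs with h
  · subst h
    ring
  · ring

theorem kernelPoly_update (r : ℂ) : kernelPoly lam b α i z r =
    kernelPoly lam b α i (Function.update z i r) (Function.update z i r i) := by
  unfold kernelPoly
  split_ifs with h
  · rw [nextVar_update, Function.update_self]
  · rw [nextVar_update, Function.update_self, Function.update_of_ne (Ne.symm h)]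

/-- The monic polynomial `r ^ 2 - s r + p` with `1 + ‖p‖ < ‖s‖` has exactly one root in the open
unit disc: if both roots or none were there, `(1 - ‖r₁‖) * (1 - ‖r₂‖) ≥ 0` would give
`‖s‖ ≤ ‖r₁‖ + ‖r₂‖ ≤ 1 + ‖p‖`. -/
theorem existsUnique_quadratic_root_norm_lt_one {s p : ℂ} (h : 1 + ‖p‖ < ‖s‖) :
    ∃ r : ℂ, (‖r‖ < 1 ∧ r ^ 2 - s * r + p = 0) ∧
      ∀ r' : ℂ, ‖r'‖ < 1 → r' ^ 2 - s * r' + p = 0 → r' = r := by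
  obtain ⟨D, hD⟩ := IsAlgClosed.exists_pow_nat_eq (s ^ 2 - 4 * p) (n := 2) (by norm_num)
  set r₁ := (s + D) / 2 with h₁
  set r₂ := (s - D) / 2 with h₂
  have hsum : r₁ + r₂ = s := by rw [h₁, h₂]; ring
  have hprod : r₁ * r₂ = p := by
    rw [h₁, h₂]
    linear_combination -hD / 4
  have hfac (r : ℂ) : r ^ 2 - s * r + p = (r - r₁) * (r - r₂) := by
    rw [← hsum, ← hprod]
    ring
  have hneg : (1 - ‖r₁‖) * (1 - ‖r₂‖) < 0 := by
    have h3 := norm_add_le r₁ r₂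
    have h4 : ‖r₁‖ * ‖r₂‖ = ‖p‖ := by rw [← norm_mul, hprod]
    rw [hsum] at h3
    nlinarith
  simp only [hfac]
  rcases mul_neg_iff.1 hneg with ⟨ha, hb⟩ | ⟨ha, hb⟩
  · refine ⟨r₁, ⟨by linarith, by simp⟩, fun r' hr' h0 => ?_⟩
    rcases mul_eq_zero.1 h0 with h0 | h0
    · exact sub_eq_zero.1 h0
    · rw [sub_eq_zero.1 h0] at hr'
      linarith
  · refine ⟨r₂, ⟨by linarith, by simp⟩, fun r' hr' h0 => ?_⟩
    rcases mul_eq_zero.1 h0 with h0 | h0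
    · rw [sub_eq_zero.1 h0] at hr'
      linarith
    · exact sub_eq_zero.1 h0

theorem existsUnique_kernelPoly_root (hlam : 0 < lam) (hb : 0 < b i) (hα : 0 < α i)
    (hz : ∀ j, ‖z j‖ ≤ 1) :
    ∃ r : ℂ, (‖r‖ < 1 ∧ kernelPoly lam b α i z r = 0) ∧
      ∀ r' : ℂ, ‖r'‖ < 1 → kernelPoly lam b α i z r' = 0 → r' = r := by
  have hμ : 0 < 1 / b i := by positivity
  have hw : ‖nextVar i z / (b i : ℂ)‖ ≤ 1 / b i := by
    rw [norm_div, Complex.norm_real, Real.norm_of_nonneg hb.le]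
    gcongr
    exact norm_nextVar_le hz
  set w := nextVar i z / (b i : ℂ) with hwdef
  by_cases hi : i = 0
  · have hlamC : (lam : ℂ) ≠ 0 := by exact_mod_cast hlam.ne'
    have key : 1 + ‖w / (lam : ℂ)‖ < ‖(((lam + 1 / b i + α i) / lam : ℝ) : ℂ)‖ := by
      rw [norm_div, Complex.norm_real, Complex.norm_real, Real.norm_of_nonneg hlam.le,
        Real.norm_of_nonneg (by positivity), lt_div_iff₀ hlam, add_mul,
        div_mul_cancel₀ _ hlam.ne']
      linarith
    have e (r : ℂ) : kernelPoly lam b α i z r = 0 ↔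
        r ^ 2 - (((lam + 1 / b i + α i) / lam : ℝ) : ℂ) * r + w / (lam : ℂ) = 0 := by
      have : kernelPoly lam b α i z r = lam *
          (r ^ 2 - (((lam + 1 / b i + α i) / lam : ℝ) : ℂ) * r + w / (lam : ℂ)) := by
        simp only [kernelPoly, if_pos hi, ← hwdef]
        push_cast
        field_simp
      rw [this, mul_eq_zero, or_iff_right hlamC]
    simp only [e]
    exact existsUnique_quadratic_root_norm_lt_one key
  · set c : ℂ := lam * (1 - z 0) + 1 / b i + α i with hc
    have hcn : 1 / b i < ‖c‖ := by
      refine lt_of_lt_of_le ?_ (Complex.re_le_norm c)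
      have h0 : (z 0).re ≤ 1 := (Complex.re_le_norm _).trans (hz 0)
      have : c.re = lam * (1 - (z 0).re) + 1 / b i + α i := by
        have h1 : (1 / (b i : ℂ)) = ((1 / b i : ℝ) : ℂ) := by push_cast; rfl
        rw [hc, h1]
        simp
      rw [this]
      nlinarith
    have hc0 : c ≠ 0 := norm_pos_iff.1 (hμ.trans hcn)
    have e (r : ℂ) : kernelPoly lam b α i z r = 0 ↔ r = w / c := by
      simp only [kernelPoly, if_neg hi, ← hwdef, ← hc]
      rw [eq_div_iff hc0]
      constructor <;> intro h <;> linear_combination -h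
    refine ⟨w / c, ⟨?_, (e _).2 rfl⟩, fun r' _ h => (e r').1 h⟩
    rw [norm_div, div_lt_one (hμ.trans hcn)]
    exact hw.trans_lt hcn

end Kernel

/-! ### Harmonic functions of monomial type -/

section Monomial

variable {M : ℕ}

/-- The monomial `z ^ n = ∏ j, z j ^ n j`. -/
def monomialAt (z : Fin M → ℂ) (n : Fin M → ℕ) : ℂ := ∏ j, z j ^ n j

theorem norm_monomialAt_le {z : Fin M → ℂ} (hz : ∀ j, ‖z j‖ ≤ 1) (n : Fin M → ℕ) :
    ‖monomialAt z n‖ ≤ 1 := by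
  unfold monomialAt
  rw [norm_prod]
  refine Finset.prod_le_one (fun j _ => norm_nonneg _) fun j _ => ?_
  rw [norm_pow]
  exact pow_le_one₀ (norm_nonneg _) (hz j)

theorem monomialAt_add_single (z : Fin M → ℂ) (n : Fin M → ℕ) (j : Fin M) :
    monomialAt z (n + Pi.single j 1) = z j * monomialAt z n := by
  unfold monomialAt
  simp only [Pi.add_apply, pow_add, Finset.prod_mul_distrib]
  rw [mul_comm]
  congr 1
  rw [Finset.prod_eq_single j]
  · simp
  · intro k _ hk
    simp [Pi.single_eq_of_ne hk]
  · simp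

theorem monomialAt_eq_mul_of_ne_zero (z : Fin M → ℂ) {n : Fin M → ℕ} {i : Fin M} (hn : n i ≠ 0) :
    monomialAt z n = z i * monomialAt z (Function.update n i (n i - 1)) := by
  rw [← monomialAt_add_single]
  congr 1
  funext j
  by_cases hj : j = i
  · subst hj
    simp
    omega
  · simp [hj]

theorem monomialAt_afterService (z : Fin M → ℂ) (n : Fin M → ℕ) (i : Fin M) :
    monomialAt z (afterService i n) =
      nextVar i z * monomialAt z (Function.update n i (n i - 1)) := by
  unfold afterService nextVar
  split_ifs with h
  · exact monomialAt_add_single _ _ _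
  · simp

theorem monomialAt_update_of_eq_zero (z : Fin M → ℂ) {n : Fin M → ℕ} {i : Fin M} (hn : n i = 0)
    (r : ℂ) : monomialAt (Function.update z i r) n = monomialAt z n := by
  refine Finset.prod_congr rfl fun j _ => ?_
  by_cases hj : j = i
  · subst hj
    simp [hn]
  · simp [hj]

/-- The function `z ^ n` in the states `(n, false)` and `A z* ^ n - B z ^ n` in the states
`(n, true)`, where `z*` is `z` with `i`-th entry `r`. -/
def visitHarmonic (A B : ℂ) (z : Fin M → ℂ) (i : Fin M) (r : ℂ) (x : VisitState M) : ℂ :=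
  if x.2 = true then A * monomialAt (Function.update z i r) x.1 - B * monomialAt z x.1
  else monomialAt z x.1

theorem norm_visitHarmonic_le (A B : ℂ) {z : Fin M → ℂ} (hz : ∀ j, ‖z j‖ ≤ 1) (i : Fin M) {r : ℂ}
    (hr : ‖r‖ ≤ 1) (x : VisitState M) : ‖visitHarmonic A B z i r x‖ ≤ ‖A‖ + ‖B‖ + 1 := by
  have hz' : ∀ j, ‖Function.update z i r j‖ ≤ 1 := by
    intro j
    by_cases hj : j = i
    · subst hj
      simpa using hr
    · simpa [hj] using hz j
  have h1 := norm_monomialAt_le hz x.1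
  have h2 := norm_monomialAt_le hz' x.1
  unfold visitHarmonic
  split_ifs
  · refine (norm_sub_le _ _).trans ?_
    rw [norm_mul, norm_mul]
    nlinarith [norm_nonneg A, norm_nonneg B]
  · linarith [norm_nonneg A, norm_nonneg B]

variable [NeZero M] {d : Discipline} {lam : ℝ} {b α : Fin M → ℝ} {i : Fin M} {z : Fin M → ℂ}
  {A B r : ℂ}

/-- The function `visitHarmonic` is harmonic in the states with a busy server. Arrivals, services
and the departure of the server turn `y ^ n`, where `n i ≠ 0`, into the value of the kernel
polynomial at `y i`, times `y ^ n` with one factor `y i` removed. For `y = z*` this is zero; for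
`y = z` it cancels the term `α i * z ^ n` from the values `z ^ n` after the timer expires. -/
theorem rateGenerator_visitHarmonic_of_ne_zero (hr : kernelPoly lam b α i z r = 0)
    (hB : B * kernelPoly lam b α i z (z i) = α i * z i)
    (hAB : ∀ n, visitHarmonic A B z i r (n, serverStays d i n) =
      A * monomialAt (Function.update z i r) n - B * monomialAt z n)
    {n : Fin M → ℕ} (hn : n i ≠ 0) :
    rateGenerator (visitRate d lam b α i) (visitHarmonic A B z i r) (n, true) = 0 := by
  rw [rateGenerator_visitRate_true, if_pos hn, hAB]
  simp only [visitHarmonic, if_true, Bool.false_eq_true, if_false, monomialAt_add_single,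
    monomialAt_afterService, nextVar_update]
  rw [monomialAt_eq_mul_of_ne_zero z hn, monomialAt_eq_mul_of_ne_zero (Function.update z i r) hn]
  rw [kernelPoly_update, kernelPoly_apply_self, nextVar_update] at hr
  rw [kernelPoly_apply_self] at hB
  set w := monomialAt z (Function.update n i (n i - 1))
  set w' := monomialAt (Function.update z i r) (Function.update n i (n i - 1))
  linear_combination A * w' * hr - w * hB

/-- In the states in which the server is present at an empty queue, only arrivals and the timer
contribute; harmonicity there determines the coefficient `A`. -/
theorem rateGenerator_visitHarmonic_of_eq_zero (hr : kernelPoly lam b α i z r = 0)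
    (hP : kernelPoly lam b α i z (z i) ≠ 0) (hzr : nextVar i z ≠ r)
    {n : Fin M → ℕ} (hn : n i = 0) :
    rateGenerator (visitRate d lam b α i)
      (visitHarmonic
        (α i / kernelPoly lam b α i z (z i) * ((nextVar i z - z i) * r / (nextVar i z - r)))
        (α i * z i / kernelPoly lam b α i z (z i)) z i r) (n, true) = 0 := by
  rw [rateGenerator_visitRate_true, if_neg (not_not.2 hn)]
  simp only [visitHarmonic, if_true, Bool.false_eq_true, if_false, monomialAt_add_single,
    monomialAt_update_of_eq_zero z hn]
  set w := monomialAt z n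
  have hd : nextVar i z - r ≠ 0 := sub_ne_zero.2 hzr
  set p := kernelPoly lam b α i z (z i) with hp
  rw [kernelPoly_apply_self] at hp
  rw [kernelPoly_update, kernelPoly_apply_self, nextVar_update, Function.update_self] at hr
  set k := (nextVar i z - z i) / (nextVar i z - r) with hk
  have hkd : k * (nextVar i z - r) = nextVar i z - z i := div_mul_cancel₀ _ hd
  have hc : (nextVar i z - z i) * r / (nextVar i z - r) = k * r := by
    rw [hk]
    ring
  have hpp : α i / p * p = α i := div_mul_cancel₀ _ hP
  rw [hc, mul_div_right_comm]
  linear_combination (α i / p) * w * k * hr - (α i / p) * w / b i * hkd - w * hpp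
    + (α i / p) * w * hp

end Monomial

/-! ### The generating function at the end of a visit -/

section JointPGF

variable {M : ℕ} [NeZero M] {d : Discipline} {lam : ℝ} {b α : Fin M → ℝ} {i : Fin M}
  {Ω : Type*} {mΩ : MeasurableSpace Ω} {ℱ : Filtration ℝ≥0 mΩ} {X : ℝ≥0 → Ω → VisitState M}
  {P : Measure Ω} [IsProbabilityMeasure P]

/-- The relation between the generating functions at the two ends of a visit. The hypothesis `hAB`
says that `visitHarmonic` agrees with `A z* ^ n - B z ^ n` also where the discipline has made the
server leave an empty queue. -/
theorem IsServerVisit.jointPGF_queuesAtEnd (hX : IsServerVisit d lam b α i ℱ X P)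
    (hlam : 0 < lam) (hb : 0 < b i) (hα : 0 < α i) {z : Fin M → ℂ} (hz : ∀ j, ‖z j‖ ≤ 1)
    {A B r : ℂ} (hr : ‖r‖ ≤ 1)
    (hAB : ∀ n, visitHarmonic A B z i r (n, serverStays d i n) =
      A * monomialAt (Function.update z i r) n - B * monomialAt z n)
    (hharm : ∀ n, serverStays d i n = true →
      rateGenerator (visitRate d lam b α i) (visitHarmonic A B z i r) (n, true) = 0) :
    jointPGF P (queuesAtEnd X) z =
      A * jointPGF P (queuesAtBegin X) (Function.update z i r) -
        B * jointPGF P (queuesAtBegin X) z := by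
  have hz' : ∀ j, ‖Function.update z i r j‖ ≤ 1 := by
    intro j
    by_cases hj : j = i
    · subst hj
      simpa using hr
    · simpa [hj] using hz j
  have hint {y : Fin M → ℂ} (hy : ∀ j, ‖y j‖ ≤ 1) :
      Integrable (fun ω => monomialAt y (queuesAtBegin X ω)) P :=
    hX.chain.integrable_comp 0 (f := fun x => monomialAt y x.1)
      ⟨1, fun x => norm_monomialAt_le hy x.1⟩
  calc jointPGF P (queuesAtEnd X) z
      = ∫ ω, visitHarmonic A B z i r (queuesAtEnd X ω, false) ∂P := by
        simp [jointPGF, visitHarmonic, monomialAt]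
    _ = ∫ ω, visitHarmonic A B z i r (X 0 ω) ∂P :=
        hX.integral_end_eq_of_harmonic hlam hb hα
          ⟨_, norm_visitHarmonic_le A B hz i hr⟩ hharm
    _ = ∫ ω, (A * monomialAt (Function.update z i r) (queuesAtBegin X ω) -
          B * monomialAt z (queuesAtBegin X ω)) ∂P := by
        refine integral_congr_ae ?_
        filter_upwards [hX.start] with ω hω
        rw [queuesAtBegin, ← hAB, ← hω]
    _ = _ := by
        rw [integral_sub ((hint hz').const_mul A) ((hint hz).const_mul B), integral_const_mul,
          integral_const_mul]
        rfl

end JointPGF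

theorem mainTheorem5 {M : ℕ} [NeZero M] (lam : ℝ) (b α : Fin M → ℝ) (hlam : 0 < lam)
    (hb : ∀ j, 0 < b j) (hα : ∀ j, 0 < α j) (i : Fin M) (d : Discipline)
    {Ω : Type*} [mΩ : MeasurableSpace Ω] (P : Measure Ω) [IsProbabilityMeasure P]
    (ℱ : Filtration ℝ≥0 mΩ) (X : ℝ≥0 → Ω → VisitState M)
    (hX : IsServerVisit d lam b α i ℱ X P) :
    (∀ᵐ ω ∂P, ∃ t, (X t ω).2 = false) ∧
    AEMeasurable (queuesAtEnd X) P ∧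
    ∀ z : Fin M → ℂ, (∀ j, ‖z j‖ ≤ 1) →
      ∃ r : ℂ, (‖r‖ < 1 ∧ kernelPoly lam b α i z r = 0) ∧
        (∀ r' : ℂ, ‖r'‖ < 1 → kernelPoly lam b α i z r' = 0 → r' = r) ∧
        (d = Discipline.autonomous →
          -- the relation for pairwise distinct `z_i`, `z_{i+1}`, `r`
          (kernelPoly lam b α i z (z i) ≠ 0 → nextVar i z ≠ r → nextVar i z ≠ z i →
            jointPGF P (queuesAtEnd X) z =
              α i * (nextVar i z - z i) / kernelPoly lam b α i z (z i) *
                (r * jointPGF P (queuesAtBegin X) (Function.update z i r) / (nextVar i z - r) -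
                  z i * jointPGF P (queuesAtBegin X) z / (nextVar i z - z i))) ∧
          -- the same relation with `z_{i+1} - z_i` multiplied out
          (kernelPoly lam b α i z (z i) ≠ 0 → nextVar i z ≠ r →
            jointPGF P (queuesAtEnd X) z =
              α i / kernelPoly lam b α i z (z i) *
                ((nextVar i z - z i) * r *
                    jointPGF P (queuesAtBegin X) (Function.update z i r) / (nextVar i z - r) -
                  z i * jointPGF P (queuesAtBegin X) z))) ∧
        (d = Discipline.timeLimited →
          kernelPoly lam b α i z (z i) ≠ 0 →
            jointPGF P (queuesAtEnd X) z =
              (1 + α i * z i / kernelPoly lam b α i z (z i)) *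
                  jointPGF P (queuesAtBegin X) (Function.update z i r) -
                α i * z i / kernelPoly lam b α i z (z i) *
                  jointPGF P (queuesAtBegin X) z) := by
  refine ⟨hX.ae_exists_absent hlam (hb i) (hα i),
    hX.aemeasurable_queuesAtEnd hlam (hb i) (hα i), fun z hz => ?_⟩
  obtain ⟨r, ⟨hr1, hr⟩, huniq⟩ := existsUnique_kernelPoly_root hlam (hb i) (hα i) hz
  refine ⟨r, ⟨hr1, hr⟩, huniq, ?_, ?_⟩
  · rintro rfl
    have key (hP : kernelPoly lam b α i z (z i) ≠ 0) (hzr : nextVar i z ≠ r) :=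
      have hAB (n : Fin M → ℕ) : visitHarmonic
          (α i / kernelPoly lam b α i z (z i) * ((nextVar i z - z i) * r / (nextVar i z - r)))
          (α i * z i / kernelPoly lam b α i z (z i)) z i r
            (n, serverStays Discipline.autonomous i n) = _ := if_pos rfl
      hX.jointPGF_queuesAtEnd hlam (hb i) (hα i) hz hr1.le hAB fun n _ => by
        by_cases hn : n i = 0
        · exact rateGenerator_visitHarmonic_of_eq_zero hr hP hzr hn
        · exact rateGenerator_visitHarmonic_of_ne_zero hr (div_mul_cancel₀ _ hP) hAB hn
    refine ⟨fun hP hzr hzi => ?_, fun hP hzr => ?_⟩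
    · rw [key hP hzr]
      have h1 : nextVar i z - r ≠ 0 := sub_ne_zero.2 hzr
      have h2 : nextVar i z - z i ≠ 0 := sub_ne_zero.2 hzi
      field_simp
    · rw [key hP hzr]
      ring
  · rintro rfl hP
    have hAB (n : Fin M → ℕ) : visitHarmonic (1 + α i * z i / kernelPoly lam b α i z (z i))
        (α i * z i / kernelPoly lam b α i z (z i)) z i r
          (n, serverStays Discipline.timeLimited i n) =
        (1 + α i * z i / kernelPoly lam b α i z (z i)) * monomialAt (Function.update z i r) n -
          α i * z i / kernelPoly lam b α i z (z i) * monomialAt z n := by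
      by_cases hn : n i = 0
      · simp only [visitHarmonic, serverStays, hn, monomialAt_update_of_eq_zero z hn]
        simp
        ring
      · simp [visitHarmonic, serverStays, hn]
    refine hX.jointPGF_queuesAtEnd hlam (hb i) (hα i) hz hr1.le hAB fun n hn => ?_
    exact rateGenerator_visitHarmonic_of_ne_zero hr (div_mul_cancel₀ _ hP) hAB
      (by simpa [serverStays] using hn)
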